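/- Let $d,m\in\mathbb N$, $\varepsilon>0$. Let $X$ be an $\mathbb R^d$-valued random variable with a strictly positive density $f_X$, and let $Z$ be the $\mathbb R^m$-valued output of a randomized mechanism with strictly positive conditional density $p_Z(z\mid x)$, so that $(X,Z)$ has joint density $f_X(x)\,p_Z(z\mid x)$. Assume: (i) $x\mapsto\log f_X(x)$ and, for every $z$, $x\mapsto\log p_Z(z\mid x)$ are twice differentiable on $\mathbb R^d$; (ii) the mechanism is $\varepsilon$-Lipschitz private in the gradient form: $\|\nabla_x\log p_Z(z\mid x)\|^2\le\varepsilon^2$ for all $x,z$ (Euclidean norm); (iii) the Fisher information matrix $\mathcal I(f_X)=\mathbb E_{x\sim f_X}[\nabla\log f_X(x)\,\nabla\log f_X(x)^T]$ of the prior is finite; (iv) with $\mathcal I_{Z|X}(x)=\mathbb E_{z\sim p_Z(\cdot\mid x)}[\nabla_x\log p_Z(z\mid x)\,\nabla_x\log p_Z(z\mid x)^T]$, the null spaces of $\mathcal I_{Z|X}(x)$ and $\mathcal I(f_X)$ intersect only in $0$, for every $x$. Let $A:\mathbb R^m\to\mathbb R^d$ be any (measurable) estimator whose conditional mean $\mu(x)=\mathbb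 E_{z\sim p_Z(\cdot\mid x)}[A(z)]$ exists for every $x$. Then $\mu$ is differentiable, with Jacobian $J_\mu(x)$ say, the matrix $\mathcal I_{Z|X}(x)+\mathcal I(f_X)$ is positive definite for every $x$, and the reconstruction error $R(A)=\mathbb E\|A(Z)-X\|^2\in[0,\infty]$ satisfies $$R(A)\ \ge\ \mathbb E_{x\sim f_X}\Big[\operatorname{Tr}\big(J_\mu(x)\,(\mathcal I_{Z|X}(x)+\mathcal I(f_X))^{-1}J_\mu(x)^T\big)+\|\mu(x)-x\|^2\Big].$$ If moreover $\mu(x)=x$ for all $x$, then $$R(A)\ \ge\ \mathbb E_{x\sim f_X}\Big[\operatorname{Tr}\big((\mathcal I_{Z|X}(x)+\mathcal I(f_X))^{-1}\big)\Big]\ \ge\ \frac{d^2}{\varepsilon^2+\operatorname{Tr}\mathcal I(f_X)},$$ and in fact $\operatorname{Tr}\big((\mathcal I_{Z|X}(x)+\mathcal I(f_X))^{-1}\big)\ge d^2/(\varepsilon^2+\operatorname{Tr}\mathcal I(f_X))$ for every $x$. -/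

import Mathlib

open MeasureTheory ProbabilityTheory

noncomputable section

namespace Reconstruction

/-- A strictly positive (Lebesgue) probability density on `ℝⁿ`. -/
structure IsPosDensity {n : ℕ} (g : EuclideanSpace ℝ (Fin n) → ℝ) : Prop where
  measurable : Measurable g
  pos : ∀ y, 0 < g y
  lintegral_eq_one : ∫⁻ y, ENNReal.ofReal (g y) = 1

/-- A strictly positive conditional density `p x z = p_Z(z | x)` on `ℝᵐ` given `x ∈ ℝᵈ`. -/
structure IsPosCondDensity {d m : ℕ}
    (p : EuclideanSpace ℝ (Fin d) → EuclideanSpace ℝ (Fin m) → ℝ) : Prop where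
  measurable : Measurable (Function.uncurry p)
  density : ∀ x, IsPosDensity (p x)

/-- The measure on `ℝⁿ` with Lebesgue density `g`. -/
def law {n : ℕ} (g : EuclideanSpace ℝ (Fin n) → ℝ) : Measure (EuclideanSpace ℝ (Fin n)) :=
  volume.withDensity fun y => ENNReal.ofReal (g y)

/-- The joint law of `(X, Z)`: the measure on `ℝᵈ × ℝᵐ` with Lebesgue density
`f_X(x) p_Z(z | x)`. -/
def jointLaw {d m : ℕ} (f : EuclideanSpace ℝ (Fin d) → ℝ)
    (p : EuclideanSpace ℝ (Fin d) → EuclideanSpace ℝ (Fin m) → ℝ) :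
    Measure (EuclideanSpace ℝ (Fin d) × EuclideanSpace ℝ (Fin m)) :=
  volume.withDensity fun w => ENNReal.ofReal (f w.1 * p w.1 w.2)

/-- Twice differentiability on `ℝᵈ` (no continuity of the second derivative is required). -/
def TwiceDifferentiable {d : ℕ} (g : EuclideanSpace ℝ (Fin d) → ℝ) : Prop :=
  Differentiable ℝ g ∧ Differentiable ℝ (gradient g)

/-- The score `∇ₓ log f_X(x)` of the prior. -/
def priorScore {d : ℕ} (f : EuclideanSpace ℝ (Fin d) → ℝ) (x : EuclideanSpace ℝ (Fin d)) :
    EuclideanSpace ℝ (Fin d) :=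
  gradient (fun x' => Real.log (f x')) x

/-- The score `∇ₓ log p_Z(z | x)` of the mechanism. -/
def condScore {d m : ℕ} (p : EuclideanSpace ℝ (Fin d) → EuclideanSpace ℝ (Fin m) → ℝ)
    (x : EuclideanSpace ℝ (Fin d)) (z : EuclideanSpace ℝ (Fin m)) : EuclideanSpace ℝ (Fin d) :=
  gradient (fun x' => Real.log (p x' z)) x

/-- `ε`-Lipschitz privacy of a mechanism with differentiable conditional density, as the
pointwise bound on the gradient of the log density. -/
def IsLipschitzPrivate {d m : ℕ} (ε : ℝ)
    (p : EuclideanSpace ℝ (Fin d) → EuclideanSpace ℝ (Fin m) → ℝ) : Prop :=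
  ∀ x z, ‖condScore p x z‖ ^ 2 ≤ ε ^ 2

/-- The Fisher information matrix `I(f_X) = E_x[∇ log f_X(x) ∇ log f_X(x)ᵀ]` of the prior. -/
def priorFisher {d : ℕ} (f : EuclideanSpace ℝ (Fin d) → ℝ) : Matrix (Fin d) (Fin d) ℝ :=
  Matrix.of fun i j => ∫ x, priorScore f x i * priorScore f x j ∂(law f)

/-- All entries of `I(f_X)` are finite, i.e. the defining integrals converge. -/
def FinitePriorFisher {d : ℕ} (f : EuclideanSpace ℝ (Fin d) → ℝ) : Prop :=
  ∀ i j, Integrable (fun x => priorScore f x i * priorScore f x j) (law f)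

/-- The conditional Fisher information matrix
`I_{Z|X}(x) = E_{z ∼ p_Z(· | x)}[∇ₓ log p_Z(z | x) ∇ₓ log p_Z(z | x)ᵀ]`. -/
def condFisher {d m : ℕ} (p : EuclideanSpace ℝ (Fin d) → EuclideanSpace ℝ (Fin m) → ℝ)
    (x : EuclideanSpace ℝ (Fin d)) : Matrix (Fin d) (Fin d) ℝ :=
  Matrix.of fun i j => ∫ z, condScore p x z i * condScore p x z j ∂(law (p x))

/-- The matrix `I_{Z|X}(x) + I(f_X)`. -/
def totalFisher {d m : ℕ} (f : EuclideanSpace ℝ (Fin d) → ℝ)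
    (p : EuclideanSpace ℝ (Fin d) → EuclideanSpace ℝ (Fin m) → ℝ)
    (x : EuclideanSpace ℝ (Fin d)) : Matrix (Fin d) (Fin d) ℝ :=
  condFisher p x + priorFisher f

/-- The conditional mean `μ(x) = E_{z ∼ p_Z(· | x)}[A(z)]` of an estimator `A`. -/
def condMean {d m : ℕ} (p : EuclideanSpace ℝ (Fin d) → EuclideanSpace ℝ (Fin m) → ℝ)
    (A : EuclideanSpace ℝ (Fin m) → EuclideanSpace ℝ (Fin d)) (x : EuclideanSpace ℝ (Fin d)) :
    EuclideanSpace ℝ (Fin d) :=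
  ∫ z, A z ∂(law (p x))

/-- The Jacobian matrix `(∂ uᵢ / ∂ xⱼ)ᵢⱼ` of a vector field on `ℝᵈ`. -/
def jacobian {d : ℕ} (u : EuclideanSpace ℝ (Fin d) → EuclideanSpace ℝ (Fin d))
    (x : EuclideanSpace ℝ (Fin d)) : Matrix (Fin d) (Fin d) ℝ :=
  Matrix.of fun i j => fderiv ℝ u x (EuclideanSpace.single j 1) i

/-- The reconstruction error `R(A) = E ‖A(Z) - X‖²`, as an element of `[0, ∞]`. -/
def reconstructionError {Ω : Type*} [MeasurableSpace Ω] (P : Measure Ω) {d m : ℕ}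
    (X : Ω → EuclideanSpace ℝ (Fin d)) (Z : Ω → EuclideanSpace ℝ (Fin m))
    (A : EuclideanSpace ℝ (Fin m) → EuclideanSpace ℝ (Fin d)) : ENNReal :=
  ∫⁻ ω, ENNReal.ofReal (‖A (Z ω) - X ω‖ ^ 2) ∂P

end Reconstruction

end

namespace Reconstruction

/-! The bound is a Cramér–Rao inequality at each fixed `x`, afterwards integrated over the prior.
Write `S` for the mechanism's score at `x`. Privacy bounds `S` by `ε` and makes `log p`
`ε`-Lipschitz in `x`, so conditional expectations can be differentiated under the integral
(`hasFDerivAt_integral_law`). Hence `E[S] = 0` and `J = E[A Sᵀ]`.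

For each coordinate `i` and vector `b`, expanding `E[(Aᵢ - μᵢ - b·S)²] ≥ 0` gives `2 b·Jᵢ - bᵀ
I_{Z|X} b ≤ Var Aᵢ` (`cramerRao_coord`). Since `I(f_X)` is positive semidefinite, `I_{Z|X}` may be
replaced by the larger, invertible `M = I_{Z|X} + I(f_X)`. Taking `b = M⁻¹ Jᵢ` and summing over `i`
yields `Tr(J M⁻¹ Jᵀ)`; the squared bias is added separately (`ofReal_cramerRao_le`). Tonelli turns
the integrated bound into one on `R(A)`.

In the unbiased case `J = 1`, and the last estimate is the harmonic–arithmetic mean inequality with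
`Tr I_{Z|X} ≤ ε²`. -/

lemma IsPosDensity.isProbabilityMeasure {n : ℕ} {g : EuclideanSpace ℝ (Fin n) → ℝ}
    (hg : IsPosDensity g) : IsProbabilityMeasure (law g) :=
  ⟨by rw [law, withDensity_apply _ MeasurableSet.univ, Measure.restrict_univ,
    hg.lintegral_eq_one]⟩

lemma IsPosDensity.integrable_law_iff {n : ℕ} {g : EuclideanSpace ℝ (Fin n) → ℝ}
    (hg : IsPosDensity g) {F : Type*} [NormedAddCommGroup F] [NormedSpace ℝ F]
    {h : EuclideanSpace ℝ (Fin n) → F} :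
    Integrable h (law g) ↔ Integrable (fun y => g y • h y) := by
  rw [law, integrable_withDensity_iff_integrable_smul' hg.measurable.ennreal_ofReal (by simp)]
  simp only [ENNReal.toReal_ofReal (hg.pos _).le]

lemma IsPosDensity.integral_law {n : ℕ} {g : EuclideanSpace ℝ (Fin n) → ℝ}
    (hg : IsPosDensity g) {F : Type*} [NormedAddCommGroup F] [NormedSpace ℝ F]
    (h : EuclideanSpace ℝ (Fin n) → F) :
    ∫ y, h y ∂(law g) = ∫ y, g y • h y := by
  rw [law, integral_withDensity_eq_integral_toReal_smul hg.measurable.ennreal_ofReal (by simp)]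
  simp only [ENNReal.toReal_ofReal (hg.pos _).le]

/-! ### The score and differentiation under the integral sign -/

variable {d m : ℕ} {ε : ℝ} {p : EuclideanSpace ℝ (Fin d) → EuclideanSpace ℝ (Fin m) → ℝ}

lemma norm_condScore_le (hε : 0 < ε) (hpriv : IsLipschitzPrivate ε p)
    (x : EuclideanSpace ℝ (Fin d)) (z : EuclideanSpace ℝ (Fin m)) :
    ‖condScore p x z‖ ≤ ε :=
  le_of_sq_le_sq (hpriv x z) hε.le

lemma hasFDerivAt_log_condDensity (hp2 : ∀ z, TwiceDifferentiable fun x => Real.log (p x z))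
    (x : EuclideanSpace ℝ (Fin d)) (z : EuclideanSpace ℝ (Fin m)) :
    HasFDerivAt (fun x' => Real.log (p x' z)) (innerSL ℝ (condScore p x z)) x :=
  ((hp2 z).1 x).hasGradientAt.hasFDerivAt

/-- Positivity allows writing `p = exp (log p)`, which transfers differentiability from `log p`. -/
lemma hasFDerivAt_condDensity (hp : IsPosCondDensity p)
    (hp2 : ∀ z, TwiceDifferentiable fun x => Real.log (p x z))
    (x : EuclideanSpace ℝ (Fin d)) (z : EuclideanSpace ℝ (Fin m)) :
    HasFDerivAt (fun x' => p x' z) (p x z • innerSL ℝ (condScore p x z)) x := by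
  have h := (hasFDerivAt_log_condDensity hp2 x z).exp
  simpa only [Real.exp_log ((hp.density _).pos z)] using h

/-- Lipschitz privacy: moving the input changes the conditional density by at most an
exponential factor. -/
lemma condDensity_le_exp_mul (hε : 0 < ε) (hp : IsPosCondDensity p)
    (hp2 : ∀ z, TwiceDifferentiable fun x => Real.log (p x z))
    (hpriv : IsLipschitzPrivate ε p) (x y : EuclideanSpace ℝ (Fin d))
    (z : EuclideanSpace ℝ (Fin m)) :
    p y z ≤ Real.exp (ε * ‖y - x‖) * p x z := by
  -- Mean value inequality: `log p` is `ε`-Lipschitz in the input.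
  have h := convex_univ.norm_image_sub_le_of_norm_hasFDerivWithin_le
    (fun w _ => (hasFDerivAt_log_condDensity hp2 w z).hasFDerivWithinAt)
    (fun w _ => (by simpa using norm_condScore_le hε hpriv w z :
      ‖innerSL ℝ (condScore p w z)‖ ≤ ε)) (Set.mem_univ x) (Set.mem_univ y)
  have h' := (le_abs_self _).trans h
  rw [← Real.exp_log ((hp.density y).pos z), ← Real.exp_log ((hp.density x).pos z),
    ← Real.exp_add]
  exact Real.exp_le_exp.2 (by simpa using by linarith)

/-- Each partial derivative is a pointwise limit, along steps `1/k`, of difference quotients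
measurable in `z`. -/
lemma measurable_condScore (hp : IsPosCondDensity p)
    (hp2 : ∀ z, TwiceDifferentiable fun x => Real.log (p x z))
    (x : EuclideanSpace ℝ (Fin d)) : Measurable (condScore p x) := by
  have hcoord : ∀ i, Measurable fun z => condScore p x z i := by
    intro i
    have hlim : ∀ z, Filter.Tendsto
        (fun k : ℕ => (k : ℝ) • (Real.log (p (x + (k : ℝ)⁻¹ • EuclideanSpace.single i 1) z)
          - Real.log (p x z))) Filter.atTop (nhds (condScore p x z i)) := by
      intro z
      have h := (hasFDerivAt_log_condDensity hp2 x z).lim (EuclideanSpace.single i 1)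
        (c := fun k : ℕ => (k : ℝ)) (l := Filter.atTop)
        (by simpa using tendsto_natCast_atTop_atTop (R := ℝ))
      simpa [EuclideanSpace.inner_single_right] using h
    refine measurable_of_tendsto_metrizable (fun k => ?_) (tendsto_pi_nhds.2 hlim)
    exact (((hp.density _).measurable.log).sub (hp.density _).measurable.log).const_smul (k : ℝ)
  have : Measurable fun z => (condScore p x z).ofLp := measurable_pi_iff.2 hcoord
  exact (WithLp.measurable_toLp 2 _).comp this

/-- An integrable function times a coordinate of the score is integrable. -/
lemma integrable_mul_condScore (hε : 0 < ε) (hp : IsPosCondDensity p)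
    (hp2 : ∀ z, TwiceDifferentiable fun x => Real.log (p x z))
    (hpriv : IsLipschitzPrivate ε p) (x : EuclideanSpace ℝ (Fin d))
    {h : EuclideanSpace ℝ (Fin m) → ℝ} (hh : Integrable h (law (p x))) (i : Fin d) :
    Integrable (fun z => h z * condScore p x z i) (law (p x)) := by
  refine hh.mul_bdd (c := ε) ?_ (Filter.Eventually.of_forall fun z => ?_)
  · exact ((EuclideanSpace.proj (𝕜 := ℝ) i).continuous.measurable.comp
      (measurable_condScore hp hp2 x)).aestronglyMeasurable
  · exact (PiLp.norm_apply_le _ i).trans (norm_condScore_le hε hpriv x z)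

/-- Differentiation of a conditional expectation under the integral sign. -/
lemma hasFDerivAt_integral_law (hε : 0 < ε) (hp : IsPosCondDensity p)
    (hp2 : ∀ z, TwiceDifferentiable fun x => Real.log (p x z))
    (hpriv : IsLipschitzPrivate ε p) {h : EuclideanSpace ℝ (Fin m) → ℝ} (hm : Measurable h)
    (x : EuclideanSpace ℝ (Fin d)) (hh : Integrable h (law (p x))) :
    HasFDerivAt (fun y => ∫ z, h z ∂(law (p y)))
      (∫ z, h z • innerSL ℝ (condScore p x z) ∂(law (p x))) x := by
  simp only [(hp.density _).integral_law]
  have hh' := (hp.density x).integrable_law_iff.1 hh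
  -- On the unit ball around `x` the density grows by at most a factor `exp ε` and the score is at
  -- most `ε`, which gives an integrable bound independent of `y`.
  refine hasFDerivAt_integral_of_dominated_of_fderiv_le
    (F := fun y z => p y z • h z)
    (F' := fun y z => p y z • h z • innerSL ℝ (condScore p y z))
    (s := Metric.ball x 1)
    (bound := fun z => ε * Real.exp ε * ‖p x z • h z‖) (Metric.ball_mem_nhds x one_pos)
    (Filter.Eventually.of_forall fun y =>
      ((hp.density y).measurable.smul hm).aestronglyMeasurable) hh' ?_ ?_
    (hh'.norm.const_mul _) ?_
  · exact ((hp.density x).measurable.smul (hm.smul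
      ((innerSL ℝ).continuous.measurable.comp (measurable_condScore hp hp2 x)))).aestronglyMeasurable
  · refine Filter.Eventually.of_forall fun z y hy => ?_
    have h1 := condDensity_le_exp_mul hε hp hp2 hpriv x y z
    have h2 := norm_condScore_le hε hpriv y z
    have hyx : ‖y - x‖ ≤ 1 := by simpa [dist_eq_norm] using (Metric.mem_ball.1 hy).le
    have h3 : Real.exp (ε * ‖y - x‖) ≤ Real.exp ε :=
      Real.exp_le_exp.2 (by nlinarith)
    have px := (hp.density x).pos z
    have py := (hp.density y).pos z
    simp only [norm_smul, innerSL_apply_norm, Real.norm_of_nonneg px.le, Real.norm_of_nonneg py.le]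
    calc p y z * (‖h z‖ * ‖condScore p y z‖) ≤ (Real.exp ε * p x z) * (‖h z‖ * ε) := by
          gcongr
          exact h1.trans (by gcongr)
      _ = _ := by ring
  · refine Filter.Eventually.of_forall fun z y _ => ?_
    have h := (hasFDerivAt_condDensity hp hp2 y z).mul_const (h z)
    simpa [smul_smul, mul_comm] using h

lemma integral_law_fderiv_apply (hε : 0 < ε) (hp : IsPosCondDensity p)
    (hp2 : ∀ z, TwiceDifferentiable fun x => Real.log (p x z))
    (hpriv : IsLipschitzPrivate ε p) {h : EuclideanSpace ℝ (Fin m) → ℝ} (hm : Measurable h)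
    (x : EuclideanSpace ℝ (Fin d)) (hh : Integrable h (law (p x))) (j : Fin d) :
    (∫ z, h z • innerSL ℝ (condScore p x z) ∂(law (p x))) (EuclideanSpace.single j 1) =
      ∫ z, h z * condScore p x z j ∂(law (p x)) := by
  rw [ContinuousLinearMap.integral_apply]
  · simp [EuclideanSpace.inner_single_right]
  · refine (hh.norm.mul_const ε).mono' ?_ (Filter.Eventually.of_forall fun z => ?_)
    · exact (hm.smul ((innerSL ℝ).continuous.measurable.comp
        (measurable_condScore hp hp2 x))).aestronglyMeasurable
    · simp only [norm_smul, innerSL_apply_norm]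
      gcongr
      exact norm_condScore_le hε hpriv x z

/-- The score of the mechanism is centred. -/
lemma integral_condScore (hε : 0 < ε) (hp : IsPosCondDensity p)
    (hp2 : ∀ z, TwiceDifferentiable fun x => Real.log (p x z))
    (hpriv : IsLipschitzPrivate ε p) (x : EuclideanSpace ℝ (Fin d)) (j : Fin d) :
    ∫ z, condScore p x z j ∂(law (p x)) = 0 := by
  have hprob := fun y => (hp.density y).isProbabilityMeasure
  have h1 : Integrable (fun _ : EuclideanSpace ℝ (Fin m) => (1 : ℝ)) (law (p x)) :=
    integrable_const _
  -- With integrand `1` the integral is the total mass, constant in the input, so its derivative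
  -- vanishes.
  have h := hasFDerivAt_integral_law hε hp hp2 hpriv measurable_const x h1
  have h0 : (fun y => ∫ _ : EuclideanSpace ℝ (Fin m), (1 : ℝ) ∂(law (p y))) = fun _ => 1 := by
    funext y; simp
  rw [h0] at h
  have := integral_law_fderiv_apply hε hp hp2 hpriv measurable_const x h1 j
  rw [h.unique (hasFDerivAt_const (1 : ℝ) x)] at this
  simpa using this.symm

/-! ### The conditional mean and its Jacobian -/

variable {A : EuclideanSpace ℝ (Fin m) → EuclideanSpace ℝ (Fin d)}

lemma integrable_coord {x : EuclideanSpace ℝ (Fin d)} (hA : Integrable A (law (p x)))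
    (i : Fin d) : Integrable (fun z => A z i) (law (p x)) :=
  (EuclideanSpace.proj (𝕜 := ℝ) i).integrable_comp hA

lemma condMean_apply {x : EuclideanSpace ℝ (Fin d)} (hA : Integrable A (law (p x)))
    (i : Fin d) : condMean p A x i = ∫ z, A z i ∂(law (p x)) :=
  ((EuclideanSpace.proj (𝕜 := ℝ) i).integral_comp_comm hA).symm

lemma hasFDerivAt_condMean_apply (hε : 0 < ε) (hp : IsPosCondDensity p)
    (hp2 : ∀ z, TwiceDifferentiable fun x => Real.log (p x z))
    (hpriv : IsLipschitzPrivate ε p) (hA : Measurable A)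
    (hAint : ∀ x, Integrable A (law (p x))) (x : EuclideanSpace ℝ (Fin d)) (i : Fin d) :
    HasFDerivAt (fun y => condMean p A y i)
      (∫ z, A z i • innerSL ℝ (condScore p x z) ∂(law (p x))) x := by
  simp only [fun y => condMean_apply (hAint y) i]
  exact hasFDerivAt_integral_law hε hp hp2 hpriv
    ((EuclideanSpace.proj (𝕜 := ℝ) i).continuous.measurable.comp hA) x
    (integrable_coord (hAint x) i)

lemma differentiable_condMean (hε : 0 < ε) (hp : IsPosCondDensity p)
    (hp2 : ∀ z, TwiceDifferentiable fun x => Real.log (p x z))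
    (hpriv : IsLipschitzPrivate ε p) (hA : Measurable A)
    (hAint : ∀ x, Integrable A (law (p x))) : Differentiable ℝ (condMean p A) :=
  differentiable_euclidean.2 fun i x =>
    (hasFDerivAt_condMean_apply hε hp hp2 hpriv hA hAint x i).differentiableAt

/-- As the score is centred, this makes `J` the covariance of estimator and score, the form needed
for Cramér–Rao. -/
lemma jacobian_condMean (hε : 0 < ε) (hp : IsPosCondDensity p)
    (hp2 : ∀ z, TwiceDifferentiable fun x => Real.log (p x z))
    (hpriv : IsLipschitzPrivate ε p) (hA : Measurable A)
    (hAint : ∀ x, Integrable A (law (p x))) (x : EuclideanSpace ℝ (Fin d)) (i j : Fin d) :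
    jacobian (condMean p A) x i j = ∫ z, A z i * condScore p x z j ∂(law (p x)) := by
  refine Eq.trans ?_ (integral_law_fderiv_apply (h := fun z => A z i) hε hp hp2 hpriv
    ((EuclideanSpace.proj (𝕜 := ℝ) i).continuous.measurable.comp hA) x
    (integrable_coord (hAint x) i) j)
  have h := (differentiable_condMean hε hp hp2 hpriv hA hAint x).hasFDerivAt
  have h' := (EuclideanSpace.proj (𝕜 := ℝ) i).hasFDerivAt.comp x h
  exact congrArg (fun L => L (EuclideanSpace.single j 1))
    (h'.unique (hasFDerivAt_condMean_apply hε hp hp2 hpriv hA hAint x i))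

end Reconstruction

/-! ### Second-moment matrices and trace inequalities -/

namespace Reconstruction

open Matrix

/-- The second moment of a linear form in a random vector. -/
lemma integral_sq_dotProduct {α : Type*} [MeasurableSpace α] {ν : Measure α} {d : ℕ}
    {s : α → Fin d → ℝ} (hs : ∀ i j, Integrable (fun a => s a i * s a j) ν) (v : Fin d → ℝ) :
    Integrable (fun a => (v ⬝ᵥ s a) ^ 2) ν ∧
    ∫ a, (v ⬝ᵥ s a) ^ 2 ∂ν = v ⬝ᵥ (Matrix.of fun i j => ∫ a, s a i * s a j ∂ν) *ᵥ v := by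
  have e : (fun a => (v ⬝ᵥ s a) ^ 2) =
      fun a => ∑ i, ∑ j, (v i * v j) * (s a i * s a j) := by
    funext a
    rw [sq, dotProduct, Finset.sum_mul_sum]
    exact Finset.sum_congr rfl fun i _ => Finset.sum_congr rfl fun j _ => by ring
  have hi : ∀ i j, Integrable (fun a => (v i * v j) * (s a i * s a j)) ν :=
    fun i j => (hs i j).const_mul _
  rw [e]
  refine ⟨integrable_finsetSum _ fun i _ => integrable_finsetSum _ fun j _ => hi i j, ?_⟩
  rw [integral_finsetSum _ fun i _ => integrable_finsetSum _ fun j _ => hi i j]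
  simp only [dotProduct, mulVec, Matrix.of_apply, Finset.mul_sum]
  refine Finset.sum_congr rfl fun i _ => ?_
  rw [integral_finsetSum _ fun j _ => hi i j]
  refine Finset.sum_congr rfl fun j _ => ?_
  rw [integral_const_mul]
  ring

lemma posSemidef_secondMoment {α : Type*} [MeasurableSpace α] {ν : Measure α} {d : ℕ}
    {s : α → Fin d → ℝ} (hs : ∀ i j, Integrable (fun a => s a i * s a j) ν) :
    (Matrix.of fun i j => ∫ a, s a i * s a j ∂ν).PosSemidef := by
  refine PosSemidef.of_dotProduct_mulVec_nonneg ?_ fun v => ?_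
  · ext i j
    simp [mul_comm]
  · rw [star_trivial, ← (integral_sq_dotProduct hs v).2]
    exact integral_nonneg fun a => sq_nonneg _

/-- A positive semidefinite form vanishes at `v` only if its matrix kills `v`; a zero of the sum
therefore lies in both kernels. -/
lemma posDef_add_of_ker_inf_eq_bot {d : ℕ} {M N : Matrix (Fin d) (Fin d) ℝ}
    (hM : M.PosSemidef) (hN : N.PosSemidef)
    (h : LinearMap.ker M.mulVecLin ⊓ LinearMap.ker N.mulVecLin = ⊥) : (M + N).PosDef := by
  refine PosDef.of_dotProduct_mulVec_pos (hM.add hN).isHermitian fun v hv => ?_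
  have h1 := hM.dotProduct_mulVec_nonneg v
  have h2 := hN.dotProduct_mulVec_nonneg v
  rw [add_mulVec, dotProduct_add]
  refine lt_of_le_of_ne (add_nonneg h1 h2) fun h0 => hv ?_
  have e1 := (hM.dotProduct_mulVec_zero_iff v).1 (by linarith)
  have e2 := (hN.dotProduct_mulVec_zero_iff v).1 (by linarith)
  have : v ∈ LinearMap.ker M.mulVecLin ⊓ LinearMap.ker N.mulVecLin := by simp [e1, e2]
  rw [h] at this
  simpa using this

/-- The harmonic–arithmetic mean inequality for the eigenvalues of a positive definite matrix. -/
lemma sq_card_le_trace_inv_mul_trace {d : ℕ} {M : Matrix (Fin d) (Fin d) ℝ} (hM : M.PosDef)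
    {t : ℝ} (ht : 0 < t) (hMt : M.trace ≤ t) : (d : ℝ) ^ 2 / t ≤ M⁻¹.trace := by
  -- Nonnegativity of the trace of `(1 - cM) M⁻¹ (1 - cM)ᵀ` gives `Tr M⁻¹ ≥ 2cd - c² Tr M ≥ 2cd - c²
  -- t`; this `c` maximises the last expression.
  set c : ℝ := d / t
  have hu : IsUnit M.det := M.isUnit_iff_isUnit_det.1 hM.isUnit
  have hT : Mᵀ = M := by simpa using hM.isHermitian.eq
  have h := (hM.inv.posSemidef.mul_mul_conjTranspose_same (1 - c • M)).trace_nonneg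
  have e : (1 - c • M) * M⁻¹ * (1 - c • M)ᴴ = M⁻¹ - (2 * c) • 1 + (c * c) • M := by
    rw [conjTranspose_eq_transpose_of_trivial]
    simp only [transpose_sub, transpose_one, transpose_smul, hT, sub_mul, mul_sub, one_mul,
      mul_one, smul_mul_assoc, mul_smul_comm, M.mul_nonsing_inv hu, M.nonsing_inv_mul hu]
    module
  rw [e] at h
  simp only [trace_add, trace_sub, trace_smul, trace_one, Fintype.card_fin, smul_eq_mul] at h
  have h2 : c * c * M.trace ≤ c * c * t := mul_le_mul_of_nonneg_left hMt (mul_self_nonneg c)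
  have h3 : c * t = d := div_mul_cancel₀ _ ht.ne'
  have h4 : (d : ℝ) ^ 2 / t = c * d := by simp only [c]; ring
  rw [h4]
  have h5 : c * c * t = c * d := by rw [mul_assoc, h3]
  linarith

/-! ### The conditional Cramér–Rao bound -/

variable {d m : ℕ} {ε : ℝ} {f : EuclideanSpace ℝ (Fin d) → ℝ}
  {p : EuclideanSpace ℝ (Fin d) → EuclideanSpace ℝ (Fin m) → ℝ}
  {A : EuclideanSpace ℝ (Fin m) → EuclideanSpace ℝ (Fin d)}

lemma integrable_condScore (hε : 0 < ε) (hp : IsPosCondDensity p)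
    (hp2 : ∀ z, TwiceDifferentiable fun x => Real.log (p x z))
    (hpriv : IsLipschitzPrivate ε p) (x : EuclideanSpace ℝ (Fin d)) (i : Fin d) :
    Integrable (fun z => condScore p x z i) (law (p x)) := by
  have := (hp.density x).isProbabilityMeasure
  simpa using integrable_mul_condScore hε hp hp2 hpriv x (integrable_const (1 : ℝ)) i

lemma integrable_condScore_mul (hε : 0 < ε) (hp : IsPosCondDensity p)
    (hp2 : ∀ z, TwiceDifferentiable fun x => Real.log (p x z))
    (hpriv : IsLipschitzPrivate ε p) (x : EuclideanSpace ℝ (Fin d)) (i j : Fin d) :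
    Integrable (fun z => condScore p x z i * condScore p x z j) (law (p x)) :=
  integrable_mul_condScore hε hp hp2 hpriv x (integrable_condScore hε hp hp2 hpriv x i) j

lemma priorFisher_posSemidef (hfisher : FinitePriorFisher f) : (priorFisher f).PosSemidef :=
  posSemidef_secondMoment (s := fun x => (priorScore f x).ofLp) hfisher

lemma condFisher_posSemidef (hε : 0 < ε) (hp : IsPosCondDensity p)
    (hp2 : ∀ z, TwiceDifferentiable fun x => Real.log (p x z))
    (hpriv : IsLipschitzPrivate ε p) (x : EuclideanSpace ℝ (Fin d)) :
    (condFisher p x).PosSemidef :=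
  posSemidef_secondMoment (s := fun z => (condScore p x z).ofLp)
    (integrable_condScore_mul hε hp hp2 hpriv x)

/-- The trace of `S Sᵀ` is `‖S‖²`, which privacy bounds pointwise. -/
lemma trace_condFisher_le (hε : 0 < ε) (hp : IsPosCondDensity p)
    (hp2 : ∀ z, TwiceDifferentiable fun x => Real.log (p x z))
    (hpriv : IsLipschitzPrivate ε p) (x : EuclideanSpace ℝ (Fin d)) :
    (condFisher p x).trace ≤ ε ^ 2 := by
  have := (hp.density x).isProbabilityMeasure
  have hi := fun i => integrable_condScore_mul hε hp hp2 hpriv x i i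
  have e : (condFisher p x).trace =
      ∫ z, ∑ i, condScore p x z i * condScore p x z i ∂(law (p x)) := by
    rw [integral_finsetSum _ fun i _ => hi i]
    rfl
  rw [e]
  calc _ ≤ ∫ _, ε ^ 2 ∂(law (p x)) := by
        refine integral_mono (integrable_finsetSum _ fun i _ => hi i) (integrable_const _)
          fun z => ?_
        have := hpriv x z
        rw [EuclideanSpace.real_norm_sq_eq] at this
        simpa only [sq] using this
    _ = ε ^ 2 := by simp

/-- One row of the Cramér–Rao inequality, tested against a fixed linear form `b` in the score. -/
lemma cramerRao_coord (hε : 0 < ε) (hp : IsPosCondDensity p)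
    (hp2 : ∀ z, TwiceDifferentiable fun x => Real.log (p x z))
    (hpriv : IsLipschitzPrivate ε p) (hA : Measurable A)
    (hAint : ∀ x, Integrable A (law (p x))) (x : EuclideanSpace ℝ (Fin d)) (i : Fin d)
    (hsq : Integrable (fun z => (A z i - x i) ^ 2) (law (p x))) (b : Fin d → ℝ) :
    2 * b ⬝ᵥ jacobian (condMean p A) x i - b ⬝ᵥ condFisher p x *ᵥ b +
        (condMean p A x i - x i) ^ 2 ≤ ∫ z, (A z i - x i) ^ 2 ∂(law (p x)) := by
  have hprob := (hp.density x).isProbabilityMeasure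
  set μ := condMean p A x i with hμ
  have hAi := integrable_coord (hAint x) i
  have hS := integrable_condScore hε hp hp2 hpriv x
  have hAS := fun j => integrable_mul_condScore hε hp hp2 hpriv x hAi j
  obtain ⟨hq, hqe⟩ := integral_sq_dotProduct (s := fun z => (condScore p x z).ofLp)
    (integrable_condScore_mul hε hp hp2 hpriv x) b
  have hl : ∀ j, Integrable (fun z => b j * (A z i * condScore p x z j - μ * condScore p x z j))
      (law (p x)) := fun j => ((hAS j).sub ((hS j).const_mul μ)).const_mul _
  -- Subtracting `μ` from `A` costs nothing because the score has mean zero.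
  have hle : ∫ z, ∑ j, b j * (A z i * condScore p x z j - μ * condScore p x z j) ∂(law (p x)) =
      b ⬝ᵥ jacobian (condMean p A) x i := by
    rw [integral_finsetSum _ fun j _ => hl j]
    refine Finset.sum_congr rfl fun j _ => ?_
    rw [integral_const_mul, integral_sub (hAS j) ((hS j).const_mul μ), integral_const_mul,
      integral_condScore hε hp hp2 hpriv x j, jacobian_condMean hε hp hp2 hpriv hA hAint]
    ring
  have hL := integrable_finsetSum Finset.univ fun j _ => hl j
  have hc : Integrable (fun z => A z i - μ) (law (p x)) := hAi.sub (integrable_const μ)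
  have hlin : Integrable (fun z => 2 * (μ - x i) * (A z i - μ) + (μ - x i) ^ 2) (law (p x)) :=
    (hc.const_mul _).add (integrable_const _)
  have hline : ∫ z, (2 * (μ - x i) * (A z i - μ) + (μ - x i) ^ 2) ∂(law (p x)) =
      (μ - x i) ^ 2 := by
    rw [integral_add (hc.const_mul _) (integrable_const _),
      integral_const_mul, integral_sub hAi (integrable_const μ), ← condMean_apply (hAint x) i]
    simp [hμ]
  have hd : Integrable (fun z => 2 * ∑ j, b j * (A z i * condScore p x z j - μ * condScore p x z j)
      - (b ⬝ᵥ (condScore p x z).ofLp) ^ 2) (law (p x)) := (hL.const_mul 2).sub hq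
  rw [← hle, ← hline]
  change _ - b ⬝ᵥ (Matrix.of fun i j => ∫ z, (condScore p x z).ofLp i * (condScore p x z).ofLp j
    ∂(law (p x))) *ᵥ b + _ ≤ _
  rw [← hqe, ← integral_const_mul, ← integral_sub (hL.const_mul 2) hq,
    ← integral_add hd hlin]
  refine integral_mono (hd.add hlin) hsq fun z => ?_
  have e : ∑ j, b j * (A z i * condScore p x z j - μ * condScore p x z j) =
      (A z i - μ) * (b ⬝ᵥ (condScore p x z).ofLp) := by
    rw [dotProduct, Finset.mul_sum]
    exact Finset.sum_congr rfl fun j _ => by ring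
  simp only [e]
  -- The difference of the two integrands is exactly this square.
  nlinarith [sq_nonneg (A z i - μ - b ⬝ᵥ (condScore p x z).ofLp)]

/-- The conditional bias–variance bound: the Cramér–Rao inequality, with the Fisher information
of the mechanism enlarged by that of the prior. -/
lemma ofReal_cramerRao_le (hε : 0 < ε) (hp : IsPosCondDensity p)
    (hp2 : ∀ z, TwiceDifferentiable fun x => Real.log (p x z))
    (hpriv : IsLipschitzPrivate ε p) (hfisher : FinitePriorFisher f) (hA : Measurable A)
    (hAint : ∀ x, Integrable A (law (p x))) (x : EuclideanSpace ℝ (Fin d))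
    (hM : (totalFisher f p x).PosDef) :
    ENNReal.ofReal ((jacobian (condMean p A) x * (totalFisher f p x)⁻¹ *
        (jacobian (condMean p A) x).transpose).trace + ‖condMean p A x - x‖ ^ 2) ≤
      ∫⁻ z, ENNReal.ofReal (‖A z - x‖ ^ 2) ∂(law (p x)) := by
  -- An infinite conditional error is trivial; a finite one supplies the square integrability that
  -- `cramerRao_coord` needs.
  by_cases htop : ∫⁻ z, ENNReal.ofReal (‖A z - x‖ ^ 2) ∂(law (p x)) = ⊤
  · rw [htop]; exact le_top
  have hmeas : Measurable fun z => ‖A z - x‖ ^ 2 := ((hA.sub_const x).norm).pow_const 2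
  have hint : Integrable (fun z => ‖A z - x‖ ^ 2) (law (p x)) :=
    (lintegral_ofReal_ne_top_iff_integrable hmeas.aestronglyMeasurable
      (Filter.Eventually.of_forall fun z => sq_nonneg _)).1 htop
  rw [← ofReal_integral_eq_lintegral_ofReal hint
    (Filter.Eventually.of_forall fun z => sq_nonneg _)]
  refine ENNReal.ofReal_le_ofReal ?_
  have hsq : ∀ i, Integrable (fun z => (A z i - x i) ^ 2) (law (p x)) := by
    intro i
    refine hint.mono' ((((EuclideanSpace.proj (𝕜 := ℝ) i).continuous.measurable.comp hA).sub_const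
      _).pow_const 2).aestronglyMeasurable (Filter.Eventually.of_forall fun z => ?_)
    rw [Real.norm_of_nonneg (sq_nonneg _), ← sq_abs]
    exact pow_le_pow_left₀ (abs_nonneg _) (PiLp.norm_apply_le (A z - x) i) 2
  simp only [EuclideanSpace.real_norm_sq_eq, PiLp.sub_apply]
  rw [integral_finsetSum _ fun i _ => hsq i]
  set J := jacobian (condMean p A) x
  set M := totalFisher f p x with hMdef
  have hu : IsUnit M.det := M.isUnit_iff_isUnit_det.1 hM.isUnit
  -- Row `i` of `J M⁻¹` maximises `2 b·Jᵢ - bᵀ M b`.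
  have hrow := Finset.sum_le_sum fun i (_ : i ∈ Finset.univ) =>
    cramerRao_coord hε hp hp2 hpriv hA hAint x i (hsq i) ((J * M⁻¹) i)
  refine le_trans ?_ hrow
  rw [Finset.sum_add_distrib, Finset.sum_sub_distrib, ← Finset.mul_sum]
  have e1 : ∑ i, (J * M⁻¹) i ⬝ᵥ J i = (J * M⁻¹ * Jᵀ).trace := rfl
  have e2 : ∀ N : Matrix (Fin d) (Fin d) ℝ, ∑ i, (J * M⁻¹) i ⬝ᵥ N *ᵥ (J * M⁻¹) i =
      (J * M⁻¹ * N * (J * M⁻¹)ᵀ).trace := by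
    intro N
    rw [Matrix.mul_assoc (J * M⁻¹) N]
    rfl
  have hMT : Mᵀ = M := by simpa using hM.isHermitian.eq
  have e3 : (J * M⁻¹ * M * (J * M⁻¹)ᵀ).trace = (J * M⁻¹ * Jᵀ).trace := by
    rw [Matrix.mul_assoc J, M.nonsing_inv_mul hu, Matrix.mul_one, transpose_mul,
      transpose_nonsing_inv, hMT, Matrix.mul_assoc]
  -- Enlarging the information by `I(f_X)` only increases the subtracted quadratic term.
  have e4 : (J * M⁻¹ * condFisher p x * (J * M⁻¹)ᵀ).trace ≤
      (J * M⁻¹ * M * (J * M⁻¹)ᵀ).trace := by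
    have := ((priorFisher_posSemidef hfisher).mul_mul_conjTranspose_same (J * M⁻¹)).trace_nonneg
    rw [conjTranspose_eq_transpose_of_trivial] at this
    have e5 : J * M⁻¹ * M * (J * M⁻¹)ᵀ = J * M⁻¹ * condFisher p x * (J * M⁻¹)ᵀ +
        J * M⁻¹ * priorFisher f * (J * M⁻¹)ᵀ := by
      rw [← Matrix.add_mul, ← Matrix.mul_add]
      rfl
    rw [e5, trace_add]
    exact le_add_of_nonneg_right this
  change _ ≤ 2 * ∑ i, (J * M⁻¹) i ⬝ᵥ J i - _ + _
  rw [e1, e2]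
  linarith

/-- Tonelli for the product density; working in `[0, ∞]` avoids any integrability assumption on the
error. -/
lemma reconstructionError_eq {Ω : Type*} [MeasurableSpace Ω] {P : Measure Ω}
    (hf : IsPosDensity f) (hp : IsPosCondDensity p)
    {X : Ω → EuclideanSpace ℝ (Fin d)} {Z : Ω → EuclideanSpace ℝ (Fin m)}
    (hXZ : HasLaw (fun ω => (X ω, Z ω)) (jointLaw f p) P) (hA : Measurable A) :
    reconstructionError P X Z A =
      ∫⁻ x, ∫⁻ z, ENNReal.ofReal (‖A z - x‖ ^ 2) ∂(law (p x)) ∂(law f) := by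
  have hg : Measurable fun w : EuclideanSpace ℝ (Fin d) × EuclideanSpace ℝ (Fin m) =>
      ENNReal.ofReal (‖A w.2 - w.1‖ ^ 2) :=
    ((((hA.comp measurable_snd).sub measurable_fst).norm).pow_const 2).ennreal_ofReal
  have hpm : Measurable fun w : EuclideanSpace ℝ (Fin d) × EuclideanSpace ℝ (Fin m) =>
      ENNReal.ofReal (p w.1 w.2) := hp.measurable.ennreal_ofReal
  have hfp : Measurable fun w : EuclideanSpace ℝ (Fin d) × EuclideanSpace ℝ (Fin m) =>
      ENNReal.ofReal (f w.1 * p w.1 w.2) :=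
    ((hf.measurable.comp measurable_fst).mul hp.measurable).ennreal_ofReal
  have hgx : ∀ x, Measurable fun z => ENNReal.ofReal (‖A z - x‖ ^ 2) := fun x =>
    (((hA.sub_const x).norm).pow_const 2).ennreal_ofReal
  have hpx : ∀ x, Measurable fun z => ENNReal.ofReal (p x z) := fun x =>
    (hp.density x).measurable.ennreal_ofReal
  have hin : ∀ x, ∫⁻ z, ENNReal.ofReal (‖A z - x‖ ^ 2) ∂(law (p x)) =
      ∫⁻ z, ENNReal.ofReal (p x z) * ENNReal.ofReal (‖A z - x‖ ^ 2) := fun x => by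
    rw [law, lintegral_withDensity_eq_lintegral_mul _ (hpx x) (hgx x)]
    simp only [Pi.mul_apply]
  have h1 : reconstructionError P X Z A =
      ∫⁻ w, ENNReal.ofReal (‖A w.2 - w.1‖ ^ 2) ∂(jointLaw f p) := by
    rw [← hXZ.map_eq, lintegral_map' hg.aemeasurable hXZ.aemeasurable, reconstructionError]
  have h2 : ∫⁻ w, ENNReal.ofReal (‖A w.2 - w.1‖ ^ 2) ∂(jointLaw f p) =
      ∫⁻ x, ∫⁻ z, ENNReal.ofReal (f x * p x z) * ENNReal.ofReal (‖A z - x‖ ^ 2) := by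
    rw [jointLaw, lintegral_withDensity_eq_lintegral_mul _ hfp hg, Measure.volume_eq_prod,
      lintegral_prod _ (hfp.mul hg).aemeasurable]
    simp only [Pi.mul_apply]
  have h3 : ∀ x, ∫⁻ z, ENNReal.ofReal (f x * p x z) * ENNReal.ofReal (‖A z - x‖ ^ 2) =
      ENNReal.ofReal (f x) * ∫⁻ z, ENNReal.ofReal (‖A z - x‖ ^ 2) ∂(law (p x)) := fun x => by
    have hpg : Measurable fun z => ENNReal.ofReal (p x z) * ENNReal.ofReal (‖A z - x‖ ^ 2) :=
      (hpx x).mul (hgx x)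
    rw [hin, ← lintegral_const_mul _ hpg]
    simp only [ENNReal.ofReal_mul (hf.pos x).le, mul_assoc]
  have h4 : Measurable fun x => ∫⁻ z, ENNReal.ofReal (‖A z - x‖ ^ 2) ∂(law (p x)) := by
    simp only [hin]
    exact (hpm.mul hg).lintegral_prod_right'
  rw [h1, h2, law, lintegral_withDensity_eq_lintegral_mul _ hf.measurable.ennreal_ofReal h4]
  exact lintegral_congr h3

lemma jacobian_id (x : EuclideanSpace ℝ (Fin d)) : jacobian (fun y => y) x = 1 := by
  ext i j
  simp [jacobian, Matrix.one_apply]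

end Reconstruction

theorem theorem3 {Ω : Type*} [MeasurableSpace Ω] (P : Measure Ω) [IsProbabilityMeasure P]
    {d m : ℕ} (ε : ℝ) (hε : 0 < ε)
    (f : EuclideanSpace ℝ (Fin d) → ℝ) (hf : Reconstruction.IsPosDensity f)
    (p : EuclideanSpace ℝ (Fin d) → EuclideanSpace ℝ (Fin m) → ℝ)
    (hp : Reconstruction.IsPosCondDensity p)
    (X : Ω → EuclideanSpace ℝ (Fin d)) (Z : Ω → EuclideanSpace ℝ (Fin m))
    (hXZ : HasLaw (fun ω => (X ω, Z ω)) (Reconstruction.jointLaw f p) P)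
    (hf2 : Reconstruction.TwiceDifferentiable fun x => Real.log (f x))
    (hp2 : ∀ z, Reconstruction.TwiceDifferentiable fun x => Real.log (p x z))
    (hpriv : Reconstruction.IsLipschitzPrivate ε p)
    (hfisher : Reconstruction.FinitePriorFisher f)
    (hnull : ∀ x, LinearMap.ker (Reconstruction.condFisher p x).mulVecLin ⊓
      LinearMap.ker (Reconstruction.priorFisher f).mulVecLin = ⊥)
    (A : EuclideanSpace ℝ (Fin m) → EuclideanSpace ℝ (Fin d)) (hA : Measurable A)
    (hAint : ∀ x, Integrable A (Reconstruction.law (p x))) :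
    Differentiable ℝ (Reconstruction.condMean p A) ∧
    (∀ x, (Reconstruction.totalFisher f p x).PosDef) ∧
    ∫⁻ x, ENNReal.ofReal
        ((Reconstruction.jacobian (Reconstruction.condMean p A) x *
            (Reconstruction.totalFisher f p x)⁻¹ *
            (Reconstruction.jacobian (Reconstruction.condMean p A) x).transpose).trace +
          ‖Reconstruction.condMean p A x - x‖ ^ 2) ∂(Reconstruction.law f)
      ≤ Reconstruction.reconstructionError P X Z A ∧
    ((∀ x, Reconstruction.condMean p A x = x) →
      ∫⁻ x, ENNReal.ofReal ((Reconstruction.totalFisher f p x)⁻¹.trace) ∂(Reconstruction.law f)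
          ≤ Reconstruction.reconstructionError P X Z A ∧
      (∀ x, (d : ℝ) ^ 2 / (ε ^ 2 + (Reconstruction.priorFisher f).trace)
          ≤ (Reconstruction.totalFisher f p x)⁻¹.trace) ∧
      ENNReal.ofReal ((d : ℝ) ^ 2 / (ε ^ 2 + (Reconstruction.priorFisher f).trace))
          ≤ Reconstruction.reconstructionError P X Z A) := by
  have hprob := hf.isProbabilityMeasure
  have hpos : ∀ x, (Reconstruction.totalFisher f p x).PosDef := fun x =>
    Reconstruction.posDef_add_of_ker_inf_eq_bot
      (Reconstruction.condFisher_posSemidef hε hp hp2 hpriv x)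
      (Reconstruction.priorFisher_posSemidef hfisher) (hnull x)
  have hmain := lintegral_mono (μ := Reconstruction.law f) fun x =>
    Reconstruction.ofReal_cramerRao_le hε hp hp2 hpriv hfisher hA hAint x (hpos x)
  rw [← Reconstruction.reconstructionError_eq hf hp hXZ hA] at hmain
  refine ⟨Reconstruction.differentiable_condMean hε hp hp2 hpriv hA hAint, hpos, hmain,
    fun hunb => ?_⟩
  have htr : ∀ x, (d : ℝ) ^ 2 / (ε ^ 2 + (Reconstruction.priorFisher f).trace)
      ≤ (Reconstruction.totalFisher f p x)⁻¹.trace := by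
    intro x
    refine Reconstruction.sq_card_le_trace_inv_mul_trace (hpos x)
      (add_pos_of_pos_of_nonneg (pow_pos hε 2)
        (Reconstruction.priorFisher_posSemidef hfisher).trace_nonneg) ?_
    rw [Reconstruction.totalFisher, Matrix.trace_add]
    exact add_le_add_left (Reconstruction.trace_condFisher_le hε hp hp2 hpriv x) _
  have hid : Reconstruction.condMean p A = fun x => x := funext hunb
  have hunbiased : ∫⁻ x, ENNReal.ofReal ((Reconstruction.totalFisher f p x)⁻¹.trace)
      ∂(Reconstruction.law f) ≤ Reconstruction.reconstructionError P X Z A := by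
    -- Unbiasedness makes the Jacobian the identity and the bias term zero.
    simpa [hid, Reconstruction.jacobian_id] using hmain
  refine ⟨hunbiased, htr, le_trans ?_ hunbiased⟩
  calc ENNReal.ofReal ((d : ℝ) ^ 2 / (ε ^ 2 + (Reconstruction.priorFisher f).trace))
      = ∫⁻ _, ENNReal.ofReal ((d : ℝ) ^ 2 / (ε ^ 2 + (Reconstruction.priorFisher f).trace))
          ∂(Reconstruction.law f) := by simp
    _ ≤ _ := lintegral_mono fun x => ENNReal.ofReal_le_ofReal (htr x)
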